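/- Let $n\ge 1$ and let $M_1(\phi_1,\xi_1,\eta_1,g_1)$ and $M_2(\phi_2,\xi_2,\eta_2,g_2)$ be Sasakian manifolds of the same dimension $2n+1$. Here an almost contact metric structure consists of a smooth $(1,1)$-tensor field $\phi$, vector field $\xi$, 1-form $\eta$ and Riemannian metric $g$ with $\phi^2=-I+\eta\otimes\xi$, $\eta(\xi)=1$, $\eta(X)=g(X,\xi)$ and $g(\phi X,\phi Y)=g(X,Y)-\eta(X)\eta(Y)$; it is Sasakian if it is contact metric, $d\eta(X,Y)=g(X,\phi Y)$, and normal, $[\phi,\phi]+2\,d\eta\otimes\xi=0$, where $2\,d\eta(X,Y)=X\eta(Y)-Y\eta(X)-\eta([X,Y])$ and $[\phi,\phi](X,Y)=\phi^2[X,Y]+[\phi X,\phi Y]-\phi[\phi X,Y]-\phi[X,\phi Y]$. Let $f:M_1\to M_2$ be a differentiable map whose differential $f_*$ is a quasi-isometric embedding with constants $A\ge1$, $B\ge0$, i.e. for all smooth vector fields $X,Y$ on $M_1$, at every point, $$\tfrac1A\,g_1(X,Y)-B\le g_2(f_*X,f_*Y)\le A\,g_1(X,Y)+B.$$ Let $R_1(X,Y)Z=\nabla_X\nabla_YZ-\nabla_Y\nabla_XZ-\nabla_{[X,Y]}Z$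 be the curvature tensor of the Levi-Civita connection of $g_1$, $S_1(Y,Z)=\operatorname{tr}(X\mapsto R_1(X,Y)Z)$ the Ricci tensor, $Q_1$ the Ricci operator, $g_1(Q_1X,Y)=S_1(X,Y)$, and $r_1=\operatorname{tr}Q_1$. Write $(X\wedge Y)Z=g_1(Y,Z)X-g_1(X,Z)Y$. Call $M_1$ *concircularly flat* if $R_1(X,Y)Z=\frac{r_1}{2n(2n+1)}(X\wedge Y)Z$; *projectively flat* if $R_1(X,Y)Z=\frac1{2n}[S_1(Y,Z)X-S_1(X,Z)Y]$; *conharmonically flat* if $R_1(X,Y)Z=H(X,Y)Z:=\frac1{2n-1}[S_1(Y,Z)X-S_1(X,Z)Y+g_1(Y,Z)Q_1X-g_1(X,Z)Q_1Y]$; *conformally flat* if its Weyl conformal curvature tensor vanishes, i.e. $R_1(X,Y)Z=H(X,Y)Z-\frac{r_1}{2n(2n-1)}(X\wedge Y)Z$; and *Einstein* if $S_1=\frac{r_1}{2n+1}g_1$. Then: 1. If $M_1$ is conformally flat, or conformally flat Einstein, or concircularly flat, or projectively flat, then for all smooth vector fields $X,Y,W$ on $M_1$, at every point, $$\tfrac1A\,\eta_1(R_1(Y,X)W)-B\le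 \eta_1(Y)g_2(f_*X,f_*W)-\eta_1(X)g_2(f_*Y,f_*W)\le A\,\eta_1(R_1(Y,X)W)+B.$$ 2. If $M_1$ is conharmonically flat Einstein, then, with $c_1=\frac{4n}{2n-1}$, for all smooth vector fields $X,Y,W$ on $M_1$, at every point, $$\tfrac{c_1}A\,\eta_1(R_1(Y,X)W)-B\le \eta_1(Y)g_2(f_*X,f_*W)-\eta_1(X)g_2(f_*Y,f_*W)\le c_1A\,\eta_1(R_1(Y,X)W)+B.$$ -/

import Mathlib

open Bundle Manifold VectorField
open scoped ContDiff

noncomputable section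

/-- The model space of a manifold of dimension `2n+1`. -/
abbrev ModelE (n : ℕ) : Type := EuclideanSpace ℝ (Fin (2 * n + 1))

section Riemannian

variable {n : ℕ} {M : Type*} [TopologicalSpace M] [ChartedSpace (ModelE n) M]

variable [IsManifold (𝓡 (2 * n + 1)) ∞ M]

/-- `X` is a smooth vector field on `M`, i.e. an element of `χ(M)`. -/
def IsSmoothVF (X : ∀ x : M, TangentSpace (𝓡 (2 * n + 1)) x) : Prop :=
  ContMDiff (𝓡 (2 * n + 1)) (𝓡 (2 * n + 1)).tangent ∞
    (fun x ↦ TotalSpace.mk' (ModelE n) x (X x))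

/-- Smooth Riemannian metrics on `M`. -/
abbrev RiemMetric (n : ℕ) (M : Type*) [TopologicalSpace M] [ChartedSpace (ModelE n) M]
    [IsManifold (𝓡 (2 * n + 1)) ∞ M] : Type _ :=
  ContMDiffRiemannianMetric (𝓡 (2 * n + 1)) ∞ (ModelE n)
    (fun x : M ↦ TangentSpace (𝓡 (2 * n + 1)) x)

/-- The right-hand side of the Koszul formula for `g(∇_X Y, Z)` at `x`. -/
def koszul (g : RiemMetric n M) (X Y Z : ∀ x : M, TangentSpace (𝓡 (2 * n + 1)) x) (x : M) : ℝ :=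
  (mvfderiv (𝓡 (2 * n + 1)) (fun y ↦ g.inner y (Y y) (Z y)) x (X x)
    + mvfderiv (𝓡 (2 * n + 1)) (fun y ↦ g.inner y (X y) (Z y)) x (Y x)
    - mvfderiv (𝓡 (2 * n + 1)) (fun y ↦ g.inner y (X y) (Y y)) x (Z x)
    + g.inner x (mlieBracket (𝓡 (2 * n + 1)) X Y x) (Z x)
    - g.inner x (mlieBracket (𝓡 (2 * n + 1)) X Z x) (Y x)
    - g.inner x (mlieBracket (𝓡 (2 * n + 1)) Y Z x) (X x)) / 2

/-- The Levi-Civita connection: `∇_X Y` at `x` is the unique tangent vector `v` at `x` with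
`g(v, Z) = koszul g X Y Z` for all vector fields `Z` differentiable at `x`
(it exists whenever `X` and `Y` are differentiable at `x`). -/
def leviCivita (g : RiemMetric n M) (X Y : ∀ x : M, TangentSpace (𝓡 (2 * n + 1)) x) (x : M) :
    TangentSpace (𝓡 (2 * n + 1)) x :=
  Classical.epsilon fun v : TangentSpace (𝓡 (2 * n + 1)) x ↦
    ∀ Z : ∀ y : M, TangentSpace (𝓡 (2 * n + 1)) y,
      MDifferentiableAt (𝓡 (2 * n + 1)) (𝓡 (2 * n + 1)).tangent
        (fun y ↦ TotalSpace.mk' (ModelE n) y (Z y)) x →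
      g.inner x v (Z x) = koszul g X Y Z x

theorem RiemMetric.mdifferentiableAt_inner (g : RiemMetric n M) {Y Z : ∀ x : M, TangentSpace (𝓡 (2 * n + 1)) x} {x : M}
    (hY : MDifferentiableAt (𝓡 (2 * n + 1)) (𝓡 (2 * n + 1)).tangent (fun y ↦ TotalSpace.mk' (ModelE n) y (Y y)) x) (hZ : MDifferentiableAt (𝓡 (2 * n + 1)) (𝓡 (2 * n + 1)).tangent (fun y ↦ TotalSpace.mk' (ModelE n) y (Z y)) x) :
    MDifferentiableAt (𝓡 (2 * n + 1)) 𝓘(ℝ, ℝ) (fun y ↦ g.inner y (Y y) (Z y)) x := by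
  let : RiemannianBundle (fun x : M ↦ TangentSpace (𝓡 (2 * n + 1)) x) := ⟨g.toRiemannianMetric⟩
  have : IsContMDiffRiemannianBundle (𝓡 (2 * n + 1)) 1 (ModelE n)
    (fun x : M ↦ TangentSpace (𝓡 (2 * n + 1)) x) := IsContMDiffRiemannianBundle.of_le (n := ∞) (by simp)
  exact MDifferentiableAt.inner_bundle hY hZ

theorem koszul_tensorial (g : RiemMetric n M) {X Y : ∀ x : M, TangentSpace (𝓡 (2 * n + 1)) x} {x : M}
    (hX : MDifferentiableAt (𝓡 (2 * n + 1)) (𝓡 (2 * n + 1)).tangent (fun y ↦ TotalSpace.mk' (ModelE n) y (X y)) x) (hY : MDifferentiableAt (𝓡 (2 * n + 1)) (𝓡 (2 * n + 1)).tangent (fun y ↦ TotalSpace.mk' (ModelE n) y (Y y)) x) :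
    TensorialAt (𝓡 (2 * n + 1)) (ModelE n) (fun Z ↦ koszul g X Y Z x) x where
  smul {f Z} hf hZ := by
    have h1 : mvfderiv (𝓡 (2 * n + 1)) (fun y ↦ g.inner y (Y y) ((f • Z) y)) x (X x) =
      f x * mvfderiv (𝓡 (2 * n + 1)) (fun y ↦ g.inner y (Y y) (Z y)) x (X x)
        + g.inner x (Y x) (Z x) * mvfderiv (𝓡 (2 * n + 1)) f x (X x) := by
      have := mvfderiv_fun_mul hf (RiemMetric.mdifferentiableAt_inner g hY hZ)
      have e : (fun y ↦ g.inner y (Y y) ((f • Z) y)) = fun y ↦ f y * g.inner y (Y y) (Z y) := by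
        ext y; simp
      rw [e, this]; simp
    have h2 : mvfderiv (𝓡 (2 * n + 1)) (fun y ↦ g.inner y (X y) ((f • Z) y)) x (Y x) =
      f x * mvfderiv (𝓡 (2 * n + 1)) (fun y ↦ g.inner y (X y) (Z y)) x (Y x)
        + g.inner x (X x) (Z x) * mvfderiv (𝓡 (2 * n + 1)) f x (Y x) := by
      have := mvfderiv_fun_mul hf (RiemMetric.mdifferentiableAt_inner g hX hZ)
      have e : (fun y ↦ g.inner y (X y) ((f • Z) y)) = fun y ↦ f y * g.inner y (X y) (Z y) := by
        ext y; simp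
      rw [e, this]; simp
    have s1 := g.symm x (Z x) (X x)
    have s2 := g.symm x (Z x) (Y x)
    simp only [koszul, h1, h2, mlieBracket_smul_right hf hZ]
    simp [s1, s2]
    ring
  add {Z Z'} hZ hZ' := by
    have h1 : mvfderiv (𝓡 (2 * n + 1)) (fun y ↦ g.inner y (Y y) ((Z + Z') y)) x (X x) =
      mvfderiv (𝓡 (2 * n + 1)) (fun y ↦ g.inner y (Y y) (Z y)) x (X x)
      + mvfderiv (𝓡 (2 * n + 1)) (fun y ↦ g.inner y (Y y) (Z' y)) x (X x) := by
      have := mvfderiv_fun_add (RiemMetric.mdifferentiableAt_inner g hY hZ) (RiemMetric.mdifferentiableAt_inner g hY hZ')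
      have e : (fun y ↦ g.inner y (Y y) ((Z + Z') y)) = 
        fun y ↦ g.inner y (Y y) (Z y) + g.inner y (Y y) (Z' y) := by
        ext y; simp
      rw [e, this]; simp
    have h2 : mvfderiv (𝓡 (2 * n + 1)) (fun y ↦ g.inner y (X y) ((Z + Z') y)) x (Y x) =
      mvfderiv (𝓡 (2 * n + 1)) (fun y ↦ g.inner y (X y) (Z y)) x (Y x)
      + mvfderiv (𝓡 (2 * n + 1)) (fun y ↦ g.inner y (X y) (Z' y)) x (Y x) := by
      have := mvfderiv_fun_add (RiemMetric.mdifferentiableAt_inner g hX hZ) (RiemMetric.mdifferentiableAt_inner g hX hZ')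
      have e : (fun y ↦ g.inner y (X y) ((Z + Z') y)) = 
        fun y ↦ g.inner y (X y) (Z y) + g.inner y (X y) (Z' y) := by
        ext y; simp
      rw [e, this]; simp
    simp only [koszul, h1, h2, mlieBracket_add_right hZ hZ']
    simp
    ring

/-- The vector defining `∇_X Y` at `x` exists and is unique. -/
theorem existsUnique_leviCivita (g : RiemMetric n M) {X Y : ∀ x : M, TangentSpace (𝓡 (2 * n + 1)) x} {x : M}
    (hX : MDifferentiableAt (𝓡 (2 * n + 1)) (𝓡 (2 * n + 1)).tangent (fun y ↦ TotalSpace.mk' (ModelE n) y (X y)) x) (hY : MDifferentiableAt (𝓡 (2 * n + 1)) (𝓡 (2 * n + 1)).tangent (fun y ↦ TotalSpace.mk' (ModelE n) y (Y y)) x) :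
    ∃! v : TangentSpace (𝓡 (2 * n + 1)) x, ∀ Z : ∀ y : M, TangentSpace (𝓡 (2 * n + 1)) y,
      MDifferentiableAt (𝓡 (2 * n + 1)) (𝓡 (2 * n + 1)).tangent
        (fun y ↦ TotalSpace.mk' (ModelE n) y (Z y)) x →
      g.inner x v (Z x) = koszul g X Y Z x := by
  let L := TensorialAt.mkHom _ x (koszul_tensorial g hX hY)
  let G : TangentSpace (𝓡 (2 * n + 1)) x →ₗ[ℝ] Module.Dual ℝ (TangentSpace (𝓡 (2 * n + 1)) x) :=
    { toFun := fun v ↦ (g.inner x v).toLinearMap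
      map_add' := by intros; ext; simp
      map_smul' := by intros; ext; simp }
  have hG : Function.Injective G := by
    rw [injective_iff_map_eq_zero]
    intro v hv
    by_contra h
    have h1 := g.pos x v h
    have h2 : G v v = 0 := by rw [hv]; rfl
    exact h1.ne' h2
  have : FiniteDimensional ℝ (TangentSpace (𝓡 (2 * n + 1)) x) :=
    inferInstanceAs (FiniteDimensional ℝ (ModelE n))
  have hS : Function.Surjective G :=
    (LinearMap.injective_iff_surjective_of_finrank_eq_finrank (by
      rw [Subspace.dual_finrank_eq])).1 hG
  obtain ⟨v, hv⟩ := hS L.toLinearMap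
  refine ⟨v, fun Z hZ ↦ ?_, fun v' hv' ↦ hG ?_⟩
  · have : G v (Z x) = L (Z x) := by rw [hv]; rfl
    rw [TensorialAt.mkHom_apply _ hZ] at this
    exact this
  · rw [hv]; ext w
    have := hv' (FiberBundle.extend (ModelE n) w) (FiberBundle.mdifferentiableAt_extend ..)
    simpa [L, G, TensorialAt.mkHom_apply_eq_extend] using this

/-- `R(X,Y)Z = ∇_X ∇_Y Z - ∇_Y ∇_X Z - ∇_{[X,Y]} Z` on vector fields. -/
def curvatureVF (g : RiemMetric n M) (X Y Z : ∀ x : M, TangentSpace (𝓡 (2 * n + 1)) x) (x : M) :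
    TangentSpace (𝓡 (2 * n + 1)) x :=
  leviCivita g X (leviCivita g Y Z) x - leviCivita g Y (leviCivita g X Z) x
    - leviCivita g (mlieBracket (𝓡 (2 * n + 1)) X Y) Z x

/-- The Riemannian curvature tensor `R(u,v)w` at a point. Since `R` is tensorial, its value may be
computed on any vector fields, smooth near `x`, extending the tangent vectors `u`, `v`, `w`. -/
def curvature (g : RiemMetric n M) (x : M) (u v w : TangentSpace (𝓡 (2 * n + 1)) x) :
    TangentSpace (𝓡 (2 * n + 1)) x :=
  curvatureVF g (FiberBundle.extend (ModelE n) u) (FiberBundle.extend (ModelE n) v)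
    (FiberBundle.extend (ModelE n) w) x

/-- Trace of an endomorphism of `T_x M`, computed in the coordinate basis of `T_x M`. -/
def tangentTrace (x : M) (T : TangentSpace (𝓡 (2 * n + 1)) x → TangentSpace (𝓡 (2 * n + 1)) x) :
    ℝ :=
  ∑ i : Fin (2 * n + 1), (show ModelE n from T (EuclideanSpace.single i (1 : ℝ) : ModelE n)) i

/-- The Ricci tensor `S(v,w) = tr (u ↦ R(u,v)w)`. -/
def ricci (g : RiemMetric n M) (x : M) (v w : TangentSpace (𝓡 (2 * n + 1)) x) : ℝ :=
  tangentTrace x fun u ↦ curvature g x u v w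

/-- The Ricci operator `Q`, determined by `g(Qv, w) = S(v,w)` for all `w`. -/
def ricciOp (g : RiemMetric n M) (x : M) (v : TangentSpace (𝓡 (2 * n + 1)) x) :
    TangentSpace (𝓡 (2 * n + 1)) x :=
  Classical.epsilon fun q : TangentSpace (𝓡 (2 * n + 1)) x ↦
    ∀ w : TangentSpace (𝓡 (2 * n + 1)) x, g.inner x q w = ricci g x v w

/-- The scalar curvature, the trace of the Ricci operator. -/
def scalarCurv (g : RiemMetric n M) (x : M) : ℝ :=
  tangentTrace x (ricciOp g x)

/-- The Weyl conformal curvature tensor in dimension `2n+1`. -/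
def weylTensor (g : RiemMetric n M) (x : M) (u v w : TangentSpace (𝓡 (2 * n + 1)) x) :
    TangentSpace (𝓡 (2 * n + 1)) x :=
  curvature g x u v w
    - (1 / (2 * (n : ℝ) - 1)) • (ricci g x v w • u - ricci g x u w • v
        + g.inner x v w • ricciOp g x u - g.inner x u w • ricciOp g x v)
    + (scalarCurv g x / (2 * (n : ℝ) * (2 * (n : ℝ) - 1))) •
        (g.inner x v w • u - g.inner x u w • v)

/-- The concircular curvature tensor in dimension `2n+1`. -/
def concircularTensor (g : RiemMetric n M) (x : M) (u v w : TangentSpace (𝓡 (2 * n + 1)) x) :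
    TangentSpace (𝓡 (2 * n + 1)) x :=
  curvature g x u v w
    - (scalarCurv g x / (2 * (n : ℝ) * (2 * (n : ℝ) + 1))) •
        (g.inner x v w • u - g.inner x u w • v)

/-- The conharmonic curvature tensor in dimension `2n+1`. -/
def conharmonicTensor (g : RiemMetric n M) (x : M) (u v w : TangentSpace (𝓡 (2 * n + 1)) x) :
    TangentSpace (𝓡 (2 * n + 1)) x :=
  curvature g x u v w
    - (1 / (2 * (n : ℝ) - 1)) • (ricci g x v w • u - ricci g x u w • v
        + g.inner x v w • ricciOp g x u - g.inner x u w • ricciOp g x v)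

/-- The Weyl projective curvature tensor in dimension `2n+1`. -/
def projectiveTensor (g : RiemMetric n M) (x : M) (u v w : TangentSpace (𝓡 (2 * n + 1)) x) :
    TangentSpace (𝓡 (2 * n + 1)) x :=
  curvature g x u v w - (1 / (2 * (n : ℝ))) • (ricci g x v w • u - ricci g x u w • v)

/-- Conformally flat: the Weyl conformal curvature tensor vanishes. -/
def IsConformallyFlat (g : RiemMetric n M) : Prop :=
  ∀ (x : M) (u v w : TangentSpace (𝓡 (2 * n + 1)) x), weylTensor g x u v w = 0

/-- Concircularly flat: the concircular curvature tensor vanishes. -/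
def IsConcircularlyFlat (g : RiemMetric n M) : Prop :=
  ∀ (x : M) (u v w : TangentSpace (𝓡 (2 * n + 1)) x), concircularTensor g x u v w = 0

/-- Conharmonically flat: the conharmonic curvature tensor vanishes. -/
def IsConharmonicallyFlat (g : RiemMetric n M) : Prop :=
  ∀ (x : M) (u v w : TangentSpace (𝓡 (2 * n + 1)) x), conharmonicTensor g x u v w = 0

/-- Projectively flat: the Weyl projective curvature tensor vanishes. -/
def IsProjectivelyFlat (g : RiemMetric n M) : Prop :=
  ∀ (x : M) (u v w : TangentSpace (𝓡 (2 * n + 1)) x), projectiveTensor g x u v w = 0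

/-- Einstein: `S = r / (2n+1) g`. -/
def IsEinsteinMetric (g : RiemMetric n M) : Prop :=
  ∀ (x : M) (v w : TangentSpace (𝓡 (2 * n + 1)) x),
    ricci g x v w = scalarCurv g x / (2 * (n : ℝ) + 1) * g.inner x v w

end Riemannian

/-- An almost contact metric structure `(φ, ξ, η, g)` on a `(2n+1)`-dimensional manifold. -/
structure AlmostContactMetric (n : ℕ) (M : Type*) [TopologicalSpace M]
    [ChartedSpace (ModelE n) M] [IsManifold (𝓡 (2 * n + 1)) ∞ M] where
  φ : ∀ x : M, TangentSpace (𝓡 (2 * n + 1)) x →L[ℝ] TangentSpace (𝓡 (2 * n + 1)) x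
  ξ : ∀ x : M, TangentSpace (𝓡 (2 * n + 1)) x
  η : ∀ x : M, TangentSpace (𝓡 (2 * n + 1)) x →L[ℝ] ℝ
  g : RiemMetric n M
  smooth_φ : ContMDiff (𝓡 (2 * n + 1)) ((𝓡 (2 * n + 1)).prod 𝓘(ℝ, ModelE n →L[ℝ] ModelE n)) ∞
    (fun x ↦ TotalSpace.mk' (ModelE n →L[ℝ] ModelE n)
      (E := fun x : M ↦ TangentSpace (𝓡 (2 * n + 1)) x →L[ℝ] TangentSpace (𝓡 (2 * n + 1)) x)
      x (φ x))
  smooth_ξ : IsSmoothVF ξ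
  smooth_η : ContMDiff (𝓡 (2 * n + 1)) ((𝓡 (2 * n + 1)).prod 𝓘(ℝ, ModelE n →L[ℝ] ℝ)) ∞
    (fun x ↦ TotalSpace.mk' (ModelE n →L[ℝ] ℝ)
      (E := fun x : M ↦ TangentSpace (𝓡 (2 * n + 1)) x →L[ℝ] Bundle.Trivial M ℝ x) x (η x))
  φ_φ : ∀ (x : M) (v : TangentSpace (𝓡 (2 * n + 1)) x), φ x (φ x v) = -v + η x v • ξ x
  η_ξ : ∀ x : M, η x (ξ x) = 1
  η_eq : ∀ (x : M) (v : TangentSpace (𝓡 (2 * n + 1)) x), η x v = g.inner x v (ξ x)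
  g_φ_φ : ∀ (x : M) (v w : TangentSpace (𝓡 (2 * n + 1)) x),
    g.inner x (φ x v) (φ x w) = g.inner x v w - η x v * η x w

namespace AlmostContactMetric

variable {n : ℕ} {M : Type*} [TopologicalSpace M] [ChartedSpace (ModelE n) M]
  [IsManifold (𝓡 (2 * n + 1)) ∞ M]

/-- `dη(X,Y) = (X η(Y) - Y η(X) - η([X,Y])) / 2`, the convention of contact metric geometry. -/
def dη (s : AlmostContactMetric n M) (X Y : ∀ x : M, TangentSpace (𝓡 (2 * n + 1)) x) (x : M) : ℝ :=
  (mvfderiv (𝓡 (2 * n + 1)) (fun y ↦ s.η y (Y y)) x (X x)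
    - mvfderiv (𝓡 (2 * n + 1)) (fun y ↦ s.η y (X y)) x (Y x)
    - s.η x (mlieBracket (𝓡 (2 * n + 1)) X Y x)) / 2

/-- The Nijenhuis torsion
`[φ,φ](X,Y) = φ²[X,Y] + [φX,φY] - φ[φX,Y] - φ[X,φY]`. -/
def nijenhuis (s : AlmostContactMetric n M) (X Y : ∀ x : M, TangentSpace (𝓡 (2 * n + 1)) x)
    (x : M) : TangentSpace (𝓡 (2 * n + 1)) x :=
  s.φ x (s.φ x (mlieBracket (𝓡 (2 * n + 1)) X Y x))
    + mlieBracket (𝓡 (2 * n + 1)) (fun y ↦ s.φ y (X y)) (fun y ↦ s.φ y (Y y)) x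
    - s.φ x (mlieBracket (𝓡 (2 * n + 1)) (fun y ↦ s.φ y (X y)) Y x)
    - s.φ x (mlieBracket (𝓡 (2 * n + 1)) X (fun y ↦ s.φ y (Y y)) x)

/-- Contact metric structure: `dη(X,Y) = g(X, φY)`. -/
def IsContactMetric (s : AlmostContactMetric n M) : Prop :=
  ∀ X Y : ∀ x : M, TangentSpace (𝓡 (2 * n + 1)) x, IsSmoothVF X → IsSmoothVF Y →
    ∀ x : M, s.dη X Y x = s.g.inner x (X x) (s.φ x (Y x))

/-- Normality: `[φ,φ] + 2 dη ⊗ ξ = 0`. -/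
def IsNormal (s : AlmostContactMetric n M) : Prop :=
  ∀ X Y : ∀ x : M, TangentSpace (𝓡 (2 * n + 1)) x, IsSmoothVF X → IsSmoothVF Y →
    ∀ x : M, s.nijenhuis X Y x + (2 * s.dη X Y x) • s.ξ x = 0

/-- Sasakian structure: a normal contact metric structure. -/
def IsSasakian (s : AlmostContactMetric n M) : Prop :=
  s.IsContactMetric ∧ s.IsNormal

end AlmostContactMetric

/-- The differential `f_*` of `f` is a quasi-isometric embedding with constants `A ≥ 1`, `B ≥ 0`:
`(1/A) g₁(X,Y) - B ≤ g₂(f_* X, f_* Y) ≤ A g₁(X,Y) + B` for all smooth vector fields `X`, `Y`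
on `M₁`, at every point. -/
structure IsQuasiIsometricEmbedding {n : ℕ} {M₁ M₂ : Type*}
    [TopologicalSpace M₁] [ChartedSpace (ModelE n) M₁] [IsManifold (𝓡 (2 * n + 1)) ∞ M₁]
    [TopologicalSpace M₂] [ChartedSpace (ModelE n) M₂] [IsManifold (𝓡 (2 * n + 1)) ∞ M₂]
    (g₁ : RiemMetric n M₁) (g₂ : RiemMetric n M₂) (f : M₁ → M₂) (A B : ℝ) : Prop where
  one_le : 1 ≤ A
  nonneg : 0 ≤ B
  mdifferentiable : MDifferentiable (𝓡 (2 * n + 1)) (𝓡 (2 * n + 1)) f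
  bound : ∀ X Y : ∀ x : M₁, TangentSpace (𝓡 (2 * n + 1)) x, IsSmoothVF X → IsSmoothVF Y →
    ∀ x : M₁,
      1 / A * g₁.inner x (X x) (Y x) - B ≤
        g₂.inner (f x) (mfderiv (𝓡 (2 * n + 1)) (𝓡 (2 * n + 1)) f x (X x))
          (mfderiv (𝓡 (2 * n + 1)) (𝓡 (2 * n + 1)) f x (Y x)) ∧
      g₂.inner (f x) (mfderiv (𝓡 (2 * n + 1)) (𝓡 (2 * n + 1)) f x (X x))
          (mfderiv (𝓡 (2 * n + 1)) (𝓡 (2 * n + 1)) f x (Y x)) ≤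
        A * g₁.inner x (X x) (Y x) + B

end

/-! ### Smooth functions and vector fields -/

section SmoothVectorFields

open scoped Topology

variable {n : ℕ} {M : Type*} [TopologicalSpace M] [ChartedSpace (ModelE n) M]

/-! On a Sasakian manifold the structure forces `η(R(u,v)w) = g(v,w)η(u) - g(u,w)η(v)`
(`IsSasakian.η_curvature`). With `U = η(Y)X - η(X)Y` this reads `g₁(U,W) = η(R(Y,X)W)`, while the
middle expression of the theorem is `g₂(f_*U, f_*W)`. One use of the quasi-isometry bound on the
pair `U`, `W` gives part 1.

The identity follows from `R(X,Y)ξ = η(Y)X - η(X)Y` because `R(X,Y)` is skew-adjoint. The formula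
for `R(X,Y)ξ` rests on `∇_X ξ = -φX` (`IsSasakian.leviCivita_ξ`) and `(∇_X φ)Y = g(X,Y)ξ - η(Y)X`
(`IsSasakian.covDerivφ_eq`). Both come from normality and the closedness of `Φ(X,Y) = g(X,φY)`,
which equals `dη`.

For part 2, the Einstein condition evaluated at `ξ` gives `S = 2n g`, and conharmonic flatness
becomes `R(u,v)w = c₁(g(v,w)u - g(u,w)v)`. Applying `η` yields `η(R) = c₁ η(R)`, so the factor `c₁`
can be inserted into the bounds of part 1. -/

/-- The type of (not necessarily smooth) vector fields on `M`. -/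
abbrev VF (n : ℕ) (M : Type*) [TopologicalSpace M] [ChartedSpace (ModelE n) M] : Type _ :=
  ∀ x : M, TangentSpace (𝓡 (2 * n + 1)) x

/-- The derivative `X f` of a function along a vector field. -/
noncomputable def dirDeriv (X : VF n M) (f : M → ℝ) (x : M) : ℝ :=
  mvfderiv (𝓡 (2 * n + 1)) f x (X x)

/-- Smooth real-valued functions on `M`. -/
abbrev IsSmoothFn (n : ℕ) {M : Type*} [TopologicalSpace M] [ChartedSpace (ModelE n) M]
    (f : M → ℝ) : Prop :=
  ContMDiff (𝓡 (2 * n + 1)) 𝓘(ℝ, ℝ) ∞ f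

theorem IsSmoothFn.mdifferentiableAt {f : M → ℝ} (hf : IsSmoothFn n f) (x : M) :
    MDifferentiableAt (𝓡 (2 * n + 1)) 𝓘(ℝ, ℝ) f x :=
  ContMDiff.mdifferentiable hf (by simp) x

theorem dirDeriv_add (X : VF n M) {f₁ f₂ : M → ℝ} (h₁ : IsSmoothFn n f₁) (h₂ : IsSmoothFn n f₂)
    (x : M) : dirDeriv X (fun y ↦ f₁ y + f₂ y) x = dirDeriv X f₁ x + dirDeriv X f₂ x := by
  simp [dirDeriv, mvfderiv_fun_add (h₁.mdifferentiableAt x) (h₂.mdifferentiableAt x)]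

theorem dirDeriv_sub (X : VF n M) {f₁ f₂ : M → ℝ} (h₁ : IsSmoothFn n f₁) (h₂ : IsSmoothFn n f₂)
    (x : M) : dirDeriv X (fun y ↦ f₁ y - f₂ y) x = dirDeriv X f₁ x - dirDeriv X f₂ x := by
  simp [dirDeriv, mvfderiv_fun_sub (h₁.mdifferentiableAt x) (h₂.mdifferentiableAt x)]

theorem dirDeriv_mul (X : VF n M) {f₁ f₂ : M → ℝ} (h₁ : IsSmoothFn n f₁) (h₂ : IsSmoothFn n f₂)
    (x : M) : dirDeriv X (fun y ↦ f₁ y * f₂ y) x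
      = f₁ x * dirDeriv X f₂ x + f₂ x * dirDeriv X f₁ x := by
  simp [dirDeriv, mvfderiv_fun_mul (h₁.mdifferentiableAt x) (h₂.mdifferentiableAt x)]

theorem dirDeriv_neg (X : VF n M) (f : M → ℝ) (x : M) :
    dirDeriv X (fun y ↦ -f y) x = -dirDeriv X f x := by
  simp [dirDeriv, mvfderiv_fun_neg]

theorem dirDeriv_const (X : VF n M) (c : ℝ) (x : M) : dirDeriv X (fun _ ↦ c) x = 0 := by
  simp [dirDeriv, mvfderiv_const]

variable [IsManifold (𝓡 (2 * n + 1)) ∞ M]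

theorem IsSmoothVF.mdifferentiableAt {X : VF n M} (hX : IsSmoothVF X) (x : M) :
    MDifferentiableAt (𝓡 (2 * n + 1)) (𝓡 (2 * n + 1)).tangent
      (fun y ↦ TotalSpace.mk' (ModelE n) y (X y)) x :=
  ContMDiff.mdifferentiable hX (by simp) x

theorem IsSmoothVF.neg {X : VF n M} (hX : IsSmoothVF X) : IsSmoothVF (fun y ↦ -X y) :=
  ContMDiff.neg_section hX

theorem IsSmoothVF.sub {X Y : VF n M} (hX : IsSmoothVF X) (hY : IsSmoothVF Y) :
    IsSmoothVF (fun y ↦ X y - Y y) :=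
  ContMDiff.sub_section hX hY

theorem IsSmoothVF.smul {f : M → ℝ} {X : VF n M} (hf : IsSmoothFn n f) (hX : IsSmoothVF X) :
    IsSmoothVF (fun y ↦ f y • X y) :=
  ContMDiff.smul_section hf hX

theorem IsSmoothVF.mlieBracket {X Y : VF n M} (hX : IsSmoothVF X) (hY : IsSmoothVF Y) :
    IsSmoothVF (mlieBracket (𝓡 (2 * n + 1)) X Y) := by
  have : IsManifold (𝓡 (2 * n + 1)) (minSmoothness ℝ 2) M := by
    rw [minSmoothness_of_isRCLikeNormedField]; infer_instance
  have : IsManifold (𝓡 (2 * n + 1)) ((⊤ : ℕ∞) + 1) M := ‹IsManifold (𝓡 (2 * n + 1)) ∞ M›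
  exact ContDiff.mlieBracket_vectorField (m := ⊤) (n := ⊤) hX hY
    (by rw [minSmoothness_of_isRCLikeNormedField]; exact le_rfl)

theorem IsSmoothVF.dirDeriv {X : VF n M} {f : M → ℝ} (hX : IsSmoothVF X) (hf : IsSmoothFn n f) :
    IsSmoothFn n (dirDeriv X f) := by
  have h := ContMDiff.contMDiff_tangentMap (m := ∞) hf (by simp)
  exact (contMDiff_snd_tangentBundle_modelSpace ℝ 𝓘(ℝ, ℝ)).comp (h.comp hX)

theorem RiemMetric.isSmoothFn_inner (g : RiemMetric n M) {Y Z : VF n M}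
    (hY : IsSmoothVF Y) (hZ : IsSmoothVF Z) : IsSmoothFn n (fun y ↦ g.inner y (Y y) (Z y)) := by
  let : RiemannianBundle (fun x : M ↦ TangentSpace (𝓡 (2 * n + 1)) x) := ⟨g.toRiemannianMetric⟩
  exact ContMDiff.inner_bundle (n := ∞) (F := ModelE n) hY hZ

/-! ### Global smooth extensions of local fields and tangent vectors -/

/-- Multiply by a bump function supported where the field is smooth and equal to 1 near the point.
-/
theorem exists_isSmoothVF_eventuallyEq [T2Space M] {X : VF n M} {x : M}
    {u : Set M} (hu : u ∈ 𝓝 x)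
    (hX : ContMDiffOn (𝓡 (2 * n + 1)) (𝓡 (2 * n + 1)).tangent ∞
      (fun y ↦ TotalSpace.mk' (ModelE n) y (X y)) u) :
    ∃ Y : VF n M, IsSmoothVF Y ∧ Y =ᶠ[𝓝 x] X := by
  obtain ⟨v, hvu, hv, hxv⟩ := mem_nhds_iff.1 hu
  obtain ⟨ψ, hψ, -⟩ := (SmoothBumpFunction.nhds_basis_support
    (I := 𝓡 (2 * n + 1)) (hv.mem_nhds hxv)).mem_iff.1 Filter.univ_mem
  refine ⟨(ψ : M → ℝ) • X, ContMDiffOn.smul_section_of_tsupport ψ.contMDiff.contMDiffOn hv hψ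
    (hX.mono hvu), ?_⟩
  filter_upwards [ψ.eventuallyEq_one] with y hy
  simp [show ψ y = 1 from hy]
  rfl

theorem exists_isSmoothVF_eventuallyEq_extend [T2Space M] {x : M}
    (v : TangentSpace (𝓡 (2 * n + 1)) x) :
    ∃ Y : VF n M, IsSmoothVF Y ∧ Y =ᶠ[𝓝 x] (FiberBundle.extend (ModelE n) v : VF n M) := by
  obtain ⟨u, hu, h⟩ :=
    FiberBundle.exists_contMDiffOn_extend (k := ∞) (𝓡 (2 * n + 1)) (ModelE n) v
  exact exists_isSmoothVF_eventuallyEq hu h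

theorem exists_isSmoothVF_apply_eq [T2Space M] {x : M} (v : TangentSpace (𝓡 (2 * n + 1)) x) :
    ∃ Y : VF n M, IsSmoothVF Y ∧ Y x = v := by
  obtain ⟨Y, hY, h⟩ := exists_isSmoothVF_eventuallyEq_extend v
  exact ⟨Y, hY, h.self_of_nhds.trans (FiberBundle.extend_apply_self _ v)⟩

theorem RiemMetric.eq_of_inner_eq (g : RiemMetric n M) {x : M}
    {v w : TangentSpace (𝓡 (2 * n + 1)) x} (h : ∀ z, g.inner x v z = g.inner x w z) : v = w := by
  by_contra hne
  have h1 := g.pos x (v - w) (sub_ne_zero.2 hne)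
  have h2 := h (v - w)
  simp only [map_sub, sub_apply] at h1 h2
  linarith

theorem RiemMetric.eq_of_inner_vectorField_eq [T2Space M] (g : RiemMetric n M) {x : M}
    {v w : TangentSpace (𝓡 (2 * n + 1)) x}
    (h : ∀ Z : VF n M, IsSmoothVF Z → g.inner x v (Z x) = g.inner x w (Z x)) : v = w := by
  refine g.eq_of_inner_eq fun z ↦ ?_
  obtain ⟨Z, hZ, rfl⟩ := exists_isSmoothVF_apply_eq z
  exact h Z hZ

/-! ### Jacobi identity and brackets as commutators of derivations -/

theorem jacobi_mlieBracket {X Y Z : VF n M} (hX : IsSmoothVF X) (hY : IsSmoothVF Y)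
    (hZ : IsSmoothVF Z) :
    mlieBracket (𝓡 (2 * n + 1)) X (mlieBracket (𝓡 (2 * n + 1)) Y Z)
      = mlieBracket (𝓡 (2 * n + 1)) (mlieBracket (𝓡 (2 * n + 1)) X Y) Z
        + mlieBracket (𝓡 (2 * n + 1)) Y (mlieBracket (𝓡 (2 * n + 1)) X Z) := by
  have : IsManifold (𝓡 (2 * n + 1)) (minSmoothness ℝ 3) M := by
    rw [minSmoothness_of_isRCLikeNormedField]; infer_instance
  have h2 : minSmoothness ℝ 2 ≤ ∞ := by
    rw [minSmoothness_of_isRCLikeNormedField]; exact ENat.LEInfty.out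
  exact leibniz_identity_mlieBracket (ContMDiff.of_le hX h2) (ContMDiff.of_le hY h2)
    (ContMDiff.of_le hZ h2)

theorem mlieBracket_smul_right_eq {X Z : VF n M} {f : M → ℝ} (hf : IsSmoothFn n f)
    (hZ : IsSmoothVF Z) :
    mlieBracket (𝓡 (2 * n + 1)) X (f • Z)
      = dirDeriv X f • Z + f • mlieBracket (𝓡 (2 * n + 1)) X Z := by
  funext x
  exact mlieBracket_smul_right (hf.mdifferentiableAt x) (hZ.mdifferentiableAt x)

/-- The Lie bracket acts on functions as the commutator of derivations. -/
theorem dirDeriv_mlieBracket [T2Space M] {X Y : VF n M} {f : M → ℝ} (hX : IsSmoothVF X)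
    (hY : IsSmoothVF Y) (hf : IsSmoothFn n f) (x : M) :
    dirDeriv (mlieBracket (𝓡 (2 * n + 1)) X Y) f x
      = dirDeriv X (dirDeriv Y f) x - dirDeriv Y (dirDeriv X f) x := by
  -- The dimension `2n+1` is positive, so a nonzero vector exists; it is cancelled at the end.
  obtain ⟨v, hv⟩ : ∃ v : TangentSpace (𝓡 (2 * n + 1)) x, v ≠ 0 :=
    ⟨(EuclideanSpace.single 0 1 : ModelE n), by
      intro h
      have := congrArg (fun e : ModelE n ↦ e 0) h
      rw [PiLp.single_apply, if_pos rfl] at this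
      exact one_ne_zero this⟩
  obtain ⟨Z, hZ, rfl⟩ := exists_isSmoothVF_apply_eq v
  have add_right {X A B : VF n M} (hA : IsSmoothVF A) (hB : IsSmoothVF B) :
      mlieBracket (𝓡 (2 * n + 1)) X (A + B) x
        = mlieBracket (𝓡 (2 * n + 1)) X A x + mlieBracket (𝓡 (2 * n + 1)) X B x :=
    mlieBracket_add_right (hA.mdifferentiableAt x) (hB.mdifferentiableAt x)
  have hs {h : M → ℝ} {A : VF n M} (hh : IsSmoothFn n h) (hA : IsSmoothVF A) :
      IsSmoothVF (h • A) := IsSmoothVF.smul hh hA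
  -- The Jacobi identity for `X, Y, fZ`, expanded by the Leibniz rule, minus `f` times the one for
  -- `X, Y, Z`, leaves only a multiple of `Z`; its coefficient is the claimed difference.
  have h1 := congrFun (jacobi_mlieBracket hX hY (hs hf hZ)) x
  have h2 := congrFun (jacobi_mlieBracket hX hY hZ) x
  rw [mlieBracket_smul_right_eq hf hZ, mlieBracket_smul_right_eq hf hZ, Pi.add_apply,
    mlieBracket_smul_right_eq hf hZ,
    add_right (hs (hY.dirDeriv hf) hZ) (hs hf (hY.mlieBracket hZ)),
    add_right (hs (hX.dirDeriv hf) hZ) (hs hf (hX.mlieBracket hZ)),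
    mlieBracket_smul_right_eq (hY.dirDeriv hf) hZ, mlieBracket_smul_right_eq (hX.dirDeriv hf) hZ,
    mlieBracket_smul_right_eq hf (hY.mlieBracket hZ),
    mlieBracket_smul_right_eq hf (hX.mlieBracket hZ)] at h1
  simp only [Pi.add_apply, Pi.smul_apply'] at h1 h2
  rw [h2] at h1
  have h3 : (dirDeriv (mlieBracket (𝓡 (2 * n + 1)) X Y) f x
      - (dirDeriv X (dirDeriv Y f) x - dirDeriv Y (dirDeriv X f) x)) • Z x = 0 := by
    rw [← sub_eq_zero] at h1
    rw [← neg_eq_zero, ← h1]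
    module
  rcases smul_eq_zero.1 h3 with h | h
  · exact sub_eq_zero.1 h
  · exact absurd h hv

end SmoothVectorFields

/-! ### The Levi-Civita connection -/

section LeviCivita

open scoped Topology

variable {n : ℕ} {M : Type*} [TopologicalSpace M] [ChartedSpace (ModelE n) M]

theorem IsSmoothFn.det {ι : Type*} [Fintype ι] [DecidableEq ι] {G : M → Matrix ι ι ℝ}
    (hG : ∀ i j, IsSmoothFn n fun y ↦ G y i j) : IsSmoothFn n fun y ↦ (G y).det := by
  simp only [Matrix.det_apply']
  exact contMDiff_finsetSum fun σ _ ↦ contMDiff_const.mul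
    (contMDiff_finsetProd fun i _ ↦ hG (σ i) i)

variable [IsManifold (𝓡 (2 * n + 1)) ∞ M]

/-- `leviCivita` is defined by choice; all its properties are read off from this Koszul identity. -/
theorem inner_leviCivita (g : RiemMetric n M) {X Y Z : VF n M} (hX : IsSmoothVF X)
    (hY : IsSmoothVF Y) (hZ : IsSmoothVF Z) (x : M) :
    g.inner x (leviCivita g X Y x) (Z x) = koszul g X Y Z x :=
  Classical.epsilon_spec
    (existsUnique_leviCivita g (hX.mdifferentiableAt x) (hY.mdifferentiableAt x)).exists Z
    (hZ.mdifferentiableAt x)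

theorem koszul_eq_dirDeriv (g : RiemMetric n M) (X Y Z : VF n M) (x : M) :
    koszul g X Y Z x =
      (dirDeriv X (fun y ↦ g.inner y (Y y) (Z y)) x + dirDeriv Y (fun y ↦ g.inner y (X y) (Z y)) x
        - dirDeriv Z (fun y ↦ g.inner y (X y) (Y y)) x
        + g.inner x (mlieBracket (𝓡 (2 * n + 1)) X Y x) (Z x)
        - g.inner x (mlieBracket (𝓡 (2 * n + 1)) X Z x) (Y x)
        - g.inner x (mlieBracket (𝓡 (2 * n + 1)) Y Z x) (X x)) / 2 :=
  rfl

theorem IsSmoothFn.koszul (g : RiemMetric n M) {X Y Z : VF n M} (hX : IsSmoothVF X)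
    (hY : IsSmoothVF Y) (hZ : IsSmoothVF Z) : IsSmoothFn n (koszul g X Y Z) := by
  have h1 := hX.dirDeriv (g.isSmoothFn_inner hY hZ)
  have h2 := hY.dirDeriv (g.isSmoothFn_inner hX hZ)
  have h3 := hZ.dirDeriv (g.isSmoothFn_inner hX hY)
  have h4 := g.isSmoothFn_inner (hX.mlieBracket hY) hZ
  have h5 := g.isSmoothFn_inner (hX.mlieBracket hZ) hY
  have h6 := g.isSmoothFn_inner (hY.mlieBracket hZ) hX
  exact (((((h1.add h2).sub h3).add h4).sub h5).sub h6).div_const 2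

/-- A vector field is smooth as soon as its inner products with smooth vector fields are. -/
theorem isSmoothVF_of_inner [T2Space M] (g : RiemMetric n M) {V : VF n M}
    (hV : ∀ Z : VF n M, IsSmoothVF Z → IsSmoothFn n fun y ↦ g.inner y (V y) (Z y)) :
    IsSmoothVF V := by
  intro x
  let b : Module.Basis (Fin (2 * n + 1)) ℝ (TangentSpace (𝓡 (2 * n + 1)) x) :=
    (EuclideanSpace.basisFun (Fin (2 * n + 1)) ℝ).toBasis
  -- Near `x` the fields `E i` form a smooth frame; the coefficients of `V` in it solve a linear
  -- system with the Gram matrix `G`, and Cramer's rule makes them smooth.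
  choose E hE hEb using fun i ↦ exists_isSmoothVF_apply_eq (b i)
  let G : M → Matrix (Fin (2 * n + 1)) (Fin (2 * n + 1)) ℝ :=
    fun y ↦ Matrix.of fun i j ↦ g.inner y (E i y) (E j y)
  let k : M → Fin (2 * n + 1) → ℝ := fun y j ↦ g.inner y (V y) (E j y)
  have hG : IsSmoothFn n fun y ↦ (G y).det :=
    .det fun i j ↦ g.isSmoothFn_inner (hE i) (hE j)
  have hc (i : Fin (2 * n + 1)) : IsSmoothFn n fun y ↦ (G y).cramer (k y) i := by
    simp only [Matrix.cramer_apply]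
    refine .det fun l j ↦ ?_
    rcases eq_or_ne j i with rfl | h
    · simpa [Matrix.updateCol_apply] using hV _ (hE l)
    · simpa [Matrix.updateCol_apply, h, G] using g.isSmoothFn_inner (hE l) (hE j)
  have indep {y : M} (hy : (G y).det ≠ 0) : LinearIndependent ℝ fun i ↦ E i y := by
    rw [Fintype.linearIndependent_iff]
    intro a ha
    have : Matrix.vecMul a (G y) = 0 := by
      funext j
      have := congrArg (fun v ↦ g.inner y v (E j y)) ha
      simpa [Matrix.vecMul, dotProduct, G] using this
    exact congrFun (Matrix.eq_zero_of_vecMul_eq_zero hy this)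
  -- A kernel vector of the Gram matrix at `x` would be a linear relation between basis vectors, as
  -- `g` is nondegenerate.
  have hdet : (G x).det ≠ 0 := by
    intro h0
    obtain ⟨a, ha, h⟩ := Matrix.exists_vecMul_eq_zero_iff.2 h0
    have hz : ∑ i, a i • b i = 0 := by
      refine g.eq_of_inner_eq fun z ↦ ?_
      rw [← b.sum_repr z]
      simp only [map_sum, map_smul, map_zero, zero_apply, smul_zero, Finset.sum_const_zero]
      refine Finset.sum_eq_zero fun j _ ↦ ?_
      have := congrFun h j
      simp only [Matrix.vecMul, dotProduct, G, Matrix.of_apply, hEb, Pi.zero_apply] at this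
      simp [sum_apply, this]
    exact ha (funext (Fintype.linearIndependent_iff.1 b.linearIndependent a hz))
  have hev : ∀ᶠ y in 𝓝 x, (G y).det ≠ 0 :=
    hG.continuous.continuousAt.eventually_ne hdet
  have key : ∀ᶠ y in 𝓝 x, V y = ∑ i, (((G y).det)⁻¹ * (G y).cramer (k y) i) • E i y := by
    filter_upwards [hev] with y hy
    have : FiniteDimensional ℝ (TangentSpace (𝓡 (2 * n + 1)) y) :=
      inferInstanceAs (FiniteDimensional ℝ (ModelE n))
    have hspan : ⊤ ≤ Submodule.span ℝ (Set.range fun i ↦ E i y) :=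
      ((indep hy).span_eq_top_of_card_eq_finrank' (by
        change Fintype.card (Fin (2 * n + 1)) = Module.finrank ℝ (ModelE n)
        simp)).ge
    let B := Module.Basis.mk (indep hy) hspan
    refine g.eq_of_inner_eq fun z ↦ ?_
    have hj (j : Fin (2 * n + 1)) : g.inner y (V y) (E j y) =
        g.inner y (∑ i, (((G y).det)⁻¹ * (G y).cramer (k y) i) • E i y) (E j y) := by
      have h := congrFun (Matrix.mulVec_cramer (G y) (k y)) j
      simp only [Matrix.mulVec, dotProduct, G, Matrix.of_apply, Pi.smul_apply, smul_eq_mul] at h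
      simp only [map_sum, map_smul, sum_apply, smul_apply, smul_eq_mul]
      rw [eq_comm, ← mul_right_inj' hy]
      refine Eq.trans ?_ h
      rw [Finset.mul_sum]
      refine Finset.sum_congr rfl fun i _ ↦ ?_
      rw [g.symm y (E i y) (E j y)]
      rw [← mul_assoc, mul_inv_cancel_left₀ hy, mul_comm]
    rw [← B.sum_repr z]
    simp only [map_sum, map_smul]
    exact Finset.sum_congr rfl fun j _ ↦ by
      rw [show B j = E j y by simp [B], hj j]; simp
  have hsum : ContMDiffAt (𝓡 (2 * n + 1)) (𝓡 (2 * n + 1)).tangent ∞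
      (fun y ↦ TotalSpace.mk' (ModelE n) y
        (∑ i, (((G y).det)⁻¹ * (G y).cramer (k y) i) • E i y : TangentSpace (𝓡 (2 * n + 1)) y)) x :=
    ContMDiffAt.sum_section fun i _ ↦ ContMDiffAt.smul_section
      (((hG x).inv₀ hdet).mul (hc i x)) (hE i x)
  refine hsum.congr_of_eventuallyEq ?_
  filter_upwards [key] with y hy
  rw [hy]

theorem IsSmoothVF.leviCivita [T2Space M] (g : RiemMetric n M) {X Y : VF n M}
    (hX : IsSmoothVF X) (hY : IsSmoothVF Y) : IsSmoothVF (leviCivita g X Y) := by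
  refine isSmoothVF_of_inner g fun Z hZ ↦ ?_
  simp only [inner_leviCivita g hX hY hZ]
  exact .koszul g hX hY hZ

/-- The Levi-Civita connection is metric. -/
theorem dirDeriv_inner (g : RiemMetric n M) {X Y Z : VF n M} (hX : IsSmoothVF X)
    (hY : IsSmoothVF Y) (hZ : IsSmoothVF Z) :
    dirDeriv X (fun y ↦ g.inner y (Y y) (Z y))
      = fun x ↦ g.inner x (leviCivita g X Y x) (Z x) + g.inner x (Y x) (leviCivita g X Z x) := by
  funext x
  rw [g.symm x (Y x), inner_leviCivita g hX hY hZ, inner_leviCivita g hX hZ hY,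
    koszul_eq_dirDeriv, koszul_eq_dirDeriv, mlieBracket_swap_apply (V := Z) (W := Y)]
  simp only [fun y ↦ g.symm y (Z y) (Y y), map_neg, neg_apply]
  ring

/-- The Levi-Civita connection is torsion-free. -/
theorem leviCivita_sub_leviCivita [T2Space M] (g : RiemMetric n M) {X Y : VF n M}
    (hX : IsSmoothVF X) (hY : IsSmoothVF Y) (x : M) :
    leviCivita g X Y x - leviCivita g Y X x = mlieBracket (𝓡 (2 * n + 1)) X Y x := by
  refine g.eq_of_inner_vectorField_eq fun Z hZ ↦ ?_
  rw [map_sub, sub_apply, inner_leviCivita g hX hY hZ, inner_leviCivita g hY hX hZ,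
    koszul_eq_dirDeriv, koszul_eq_dirDeriv, mlieBracket_swap_apply (V := Y) (W := X)]
  simp only [fun y ↦ g.symm y (Y y) (X y), map_neg, neg_apply]
  ring

theorem leviCivita_neg [T2Space M] (g : RiemMetric n M) {X Y : VF n M}
    (hX : IsSmoothVF X) (hY : IsSmoothVF Y) (x : M) :
    leviCivita g X (fun y ↦ -Y y) x = -leviCivita g X Y x := by
  refine g.eq_of_inner_vectorField_eq fun Z hZ ↦ ?_
  have h1 := congrFun (dirDeriv_inner g hX hY hZ) x
  have h2 := congrFun (dirDeriv_inner g hX hY.neg hZ) x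
  simp only [map_neg, neg_apply, dirDeriv_neg] at h1 h2 ⊢
  linarith

/-! ### Locality of the connection and skew-adjointness of curvature -/

theorem koszul_congr (g : RiemMetric n M) {X X' Y Y' : VF n M} (Z : VF n M) {x : M}
    (hX : X =ᶠ[𝓝 x] X') (hY : Y =ᶠ[𝓝 x] Y') : koszul g X Y Z x = koszul g X' Y' Z x := by
  have e1 : (fun y ↦ g.inner y (Y y) (Z y)) =ᶠ[𝓝 x] fun y ↦ g.inner y (Y' y) (Z y) := by
    filter_upwards [hY] with y h; rw [h]
  have e2 : (fun y ↦ g.inner y (X y) (Z y)) =ᶠ[𝓝 x] fun y ↦ g.inner y (X' y) (Z y) := by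
    filter_upwards [hX] with y h; rw [h]
  have e3 : (fun y ↦ g.inner y (X y) (Y y)) =ᶠ[𝓝 x] fun y ↦ g.inner y (X' y) (Y' y) := by
    filter_upwards [hX, hY] with y h h'; rw [h, h']
  have d {f f' : M → ℝ} (h : f =ᶠ[𝓝 x] f') :
      mvfderiv (𝓡 (2 * n + 1)) f x = mvfderiv (𝓡 (2 * n + 1)) f' x := by
    ext v
    simp only [mvfderiv, h.mfderiv_eq]
    rfl
  simp only [koszul]
  rw [d e1, d e2, d e3, hX.mlieBracket_vectorField_eq hY,
    hX.mlieBracket_vectorField_eq (Filter.EventuallyEq.refl _ Z),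
    hY.mlieBracket_vectorField_eq (Filter.EventuallyEq.refl _ Z), hX.self_of_nhds, hY.self_of_nhds]

/-- The Levi-Civita connection is a local operator. -/
theorem leviCivita_congr (g : RiemMetric n M) {X X' Y Y' : VF n M} {x : M}
    (hX : X =ᶠ[𝓝 x] X') (hY : Y =ᶠ[𝓝 x] Y') : leviCivita g X Y x = leviCivita g X' Y' x := by
  simp only [leviCivita, fun Z ↦ koszul_congr g Z hX hY]

theorem leviCivita_eventuallyEq (g : RiemMetric n M) {X X' Y Y' : VF n M} {x : M}
    (hX : X =ᶠ[𝓝 x] X') (hY : Y =ᶠ[𝓝 x] Y') : leviCivita g X Y =ᶠ[𝓝 x] leviCivita g X' Y' := by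
  filter_upwards [hX.eventuallyEq_nhds, hY.eventuallyEq_nhds] with y h h'
  exact leviCivita_congr g h h'

theorem curvatureVF_congr (g : RiemMetric n M) {X X' Y Y' Z Z' : VF n M} {x : M}
    (hX : X =ᶠ[𝓝 x] X') (hY : Y =ᶠ[𝓝 x] Y') (hZ : Z =ᶠ[𝓝 x] Z') :
    curvatureVF g X Y Z x = curvatureVF g X' Y' Z' x := by
  simp only [curvatureVF]
  rw [leviCivita_congr g hX (leviCivita_eventuallyEq g hY hZ),
    leviCivita_congr g hY (leviCivita_eventuallyEq g hX hZ),
    leviCivita_congr g (hX.mlieBracket_vectorField hY) hZ]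

/-- The curvature at a point, computed on suitable globally smooth vector fields. -/
theorem exists_curvature_eq_curvatureVF [T2Space M] (g : RiemMetric n M) {x : M}
    (u v w : TangentSpace (𝓡 (2 * n + 1)) x) :
    ∃ U V W : VF n M, IsSmoothVF U ∧ IsSmoothVF V ∧ IsSmoothVF W ∧ U x = u ∧ V x = v ∧ W x = w ∧
      curvature g x u v w = curvatureVF g U V W x := by
  obtain ⟨U, hU, hu⟩ := exists_isSmoothVF_eventuallyEq_extend u
  obtain ⟨V, hV, hv⟩ := exists_isSmoothVF_eventuallyEq_extend v
  obtain ⟨W, hW, hw⟩ := exists_isSmoothVF_eventuallyEq_extend w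
  exact ⟨U, V, W, hU, hV, hW, hu.self_of_nhds.trans (FiberBundle.extend_apply_self _ u),
    hv.self_of_nhds.trans (FiberBundle.extend_apply_self _ v),
    hw.self_of_nhds.trans (FiberBundle.extend_apply_self _ w),
    (curvatureVF_congr g hu hv hw).symm⟩

/-- The two middle terms are exchanged when `X` and `Y` are, so they drop out of the commutator of
second derivatives; this is what makes the curvature skew-adjoint. -/
theorem dirDeriv_dirDeriv_inner [T2Space M] (g : RiemMetric n M) {X Y Z W : VF n M}
    (hX : IsSmoothVF X) (hY : IsSmoothVF Y) (hZ : IsSmoothVF Z) (hW : IsSmoothVF W) (x : M) :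
    dirDeriv X (dirDeriv Y fun y ↦ g.inner y (Z y) (W y)) x
      = g.inner x (leviCivita g X (leviCivita g Y Z) x) (W x)
        + g.inner x (leviCivita g Y Z x) (leviCivita g X W x)
        + g.inner x (leviCivita g X Z x) (leviCivita g Y W x)
        + g.inner x (Z x) (leviCivita g X (leviCivita g Y W) x) := by
  rw [dirDeriv_inner g hY hZ hW,
    dirDeriv_add X (g.isSmoothFn_inner (hY.leviCivita g hZ) hW)
      (g.isSmoothFn_inner hZ (hY.leviCivita g hW)),
    dirDeriv_inner g hX (hY.leviCivita g hZ) hW, dirDeriv_inner g hX hZ (hY.leviCivita g hW)]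
  ring

/-- The curvature operator is skew-adjoint. -/
theorem inner_curvatureVF_skew [T2Space M] (g : RiemMetric n M) {X Y Z W : VF n M}
    (hX : IsSmoothVF X) (hY : IsSmoothVF Y) (hZ : IsSmoothVF Z) (hW : IsSmoothVF W) (x : M) :
    g.inner x (curvatureVF g X Y Z x) (W x) = -g.inner x (Z x) (curvatureVF g X Y W x) := by
  have h1 := dirDeriv_mlieBracket hX hY (g.isSmoothFn_inner hZ hW) x
  rw [dirDeriv_dirDeriv_inner g hX hY hZ hW, dirDeriv_dirDeriv_inner g hY hX hZ hW,
    dirDeriv_inner g (hX.mlieBracket hY) hZ hW] at h1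
  simp only [curvatureVF, map_sub, sub_apply]
  linarith

end LeviCivita

/-! ### Algebra of almost contact metric structures -/

namespace AlmostContactMetric

variable {n : ℕ} {M : Type*} [TopologicalSpace M] [ChartedSpace (ModelE n) M]
  [IsManifold (𝓡 (2 * n + 1)) ∞ M] (s : AlmostContactMetric n M)

theorem inner_ξ_right (x : M) (v : TangentSpace (𝓡 (2 * n + 1)) x) :
    s.g.inner x v (s.ξ x) = s.η x v :=
  (s.η_eq x v).symm

theorem inner_ξ_left (x : M) (v : TangentSpace (𝓡 (2 * n + 1)) x) :
    s.g.inner x (s.ξ x) v = s.η x v := by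
  rw [s.g.symm, inner_ξ_right]

/-- The squared norm of `φξ` is `g(ξ,ξ) - η(ξ)² = 0`. -/
theorem φ_ξ (x : M) : s.φ x (s.ξ x) = 0 := by
  by_contra h
  have h1 := s.g.pos x _ h
  rw [s.g_φ_φ, inner_ξ_right, s.η_ξ] at h1
  norm_num at h1

/-- Computing `φ³v` as `φ²(φv)` and as `φ(φ²v)` leaves `η(φv)ξ = 0`. -/
theorem η_φ (x : M) (v : TangentSpace (𝓡 (2 * n + 1)) x) : s.η x (s.φ x v) = 0 := by
  have h1 := s.φ_φ x (s.φ x v)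
  rw [s.φ_φ x v] at h1
  simp only [map_add, map_neg, map_smul, φ_ξ, smul_zero, add_zero, left_eq_add] at h1
  have h2 := congrArg (s.η x) h1
  simpa [s.η_ξ] using h2

theorem inner_φ_left (x : M) (v w : TangentSpace (𝓡 (2 * n + 1)) x) :
    s.g.inner x (s.φ x v) w = -s.g.inner x v (s.φ x w) := by
  have h := s.g_φ_φ x v (s.φ x w)
  rw [s.φ_φ, η_φ] at h
  simp only [map_add, map_neg, map_smul, smul_eq_mul, inner_ξ_right, η_φ] at h
  linarith

/-- The image of `φ` is the orthogonal complement of `ξ`: `φ(-φz) = z - η(z)ξ`. Vector identities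
are thus checked on `ξ` and on the image of `φ` separately. -/
theorem eq_zero_of_inner_φ {x : M} {v : TangentSpace (𝓡 (2 * n + 1)) x} (hη : s.η x v = 0)
    (h : ∀ w, s.g.inner x v (s.φ x w) = 0) : v = 0 := by
  refine s.g.eq_of_inner_eq fun z ↦ ?_
  have hz := h (-(s.φ x z))
  simp only [map_neg, s.φ_φ, map_add, map_smul, inner_ξ_right, hη, smul_zero, add_zero,
    neg_neg] at hz
  simpa using hz

theorem isSmoothVF_φ {X : VF n M} (hX : IsSmoothVF X) : IsSmoothVF fun y ↦ s.φ y (X y) :=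
  ContMDiff.clm_bundle_apply s.smooth_φ hX

theorem isSmoothFn_η {X : VF n M} (hX : IsSmoothVF X) : IsSmoothFn n fun y ↦ s.η y (X y) := by
  simp only [← inner_ξ_right]
  exact s.g.isSmoothFn_inner hX s.smooth_ξ

/-! ### Contact metric and Sasakian identities: `dΦ = 0`, `[ξ, φX]` and `∇ξ` -/

variable {s}

theorem IsContactMetric.two_mul_inner_φ (hs : s.IsContactMetric) {X Y : VF n M}
    (hX : IsSmoothVF X) (hY : IsSmoothVF Y) (x : M) :
    2 * s.g.inner x (X x) (s.φ x (Y x)) = dirDeriv X (fun y ↦ s.η y (Y y)) x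
      - dirDeriv Y (fun y ↦ s.η y (X y)) x - s.η x (mlieBracket (𝓡 (2 * n + 1)) X Y x) := by
  rw [← hs X Y hX hY x, dη, mul_div_cancel₀ _ two_ne_zero]
  rfl

theorem IsContactMetric.dirDeriv_inner_φ (hs : s.IsContactMetric) (X : VF n M) {Y Z : VF n M}
    (hY : IsSmoothVF Y) (hZ : IsSmoothVF Z) (x : M) :
    2 * dirDeriv X (fun y ↦ s.g.inner y (Y y) (s.φ y (Z y))) x
      = dirDeriv X (dirDeriv Y fun y ↦ s.η y (Z y)) x
        - dirDeriv X (dirDeriv Z fun y ↦ s.η y (Y y)) x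
        - dirDeriv X (fun y ↦ s.η y (mlieBracket (𝓡 (2 * n + 1)) Y Z y)) x := by
  have h1 := hY.dirDeriv (s.isSmoothFn_η hZ)
  have h2 := hZ.dirDeriv (s.isSmoothFn_η hY)
  have h3 := s.isSmoothFn_η (hY.mlieBracket hZ)
  rw [← dirDeriv_sub X h1 h2, ← dirDeriv_sub X (h1.sub h2) h3,
    ← (funext fun y ↦ hs.two_mul_inner_φ hY hZ y :),
    dirDeriv_mul X contMDiff_const (s.g.isSmoothFn_inner hY (s.isSmoothVF_φ hZ)), dirDeriv_const]
  ring

/-- The fundamental 2-form `(X, Y) ↦ g(X, φ Y)` of a contact metric structure is closed. -/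
theorem IsContactMetric.closed [T2Space M] (hs : s.IsContactMetric) {X Y Z : VF n M}
    (hX : IsSmoothVF X) (hY : IsSmoothVF Y) (hZ : IsSmoothVF Z) (x : M) :
    dirDeriv X (fun y ↦ s.g.inner y (Y y) (s.φ y (Z y))) x
      + dirDeriv Y (fun y ↦ s.g.inner y (Z y) (s.φ y (X y))) x
      + dirDeriv Z (fun y ↦ s.g.inner y (X y) (s.φ y (Y y))) x
      = s.g.inner x (mlieBracket (𝓡 (2 * n + 1)) X Y x) (s.φ x (Z x))
        + s.g.inner x (mlieBracket (𝓡 (2 * n + 1)) Y Z x) (s.φ x (X x))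
        + s.g.inner x (mlieBracket (𝓡 (2 * n + 1)) Z X x) (s.φ x (Y x)) := by
  have a1 := hs.dirDeriv_inner_φ X hY hZ x
  have a2 := hs.dirDeriv_inner_φ Y hZ hX x
  have a3 := hs.dirDeriv_inner_φ Z hX hY x
  have b1 := hs.two_mul_inner_φ (hX.mlieBracket hY) hZ x
  have b2 := hs.two_mul_inner_φ (hY.mlieBracket hZ) hX x
  have b3 := hs.two_mul_inner_φ (hZ.mlieBracket hX) hY x
  have c1 := dirDeriv_mlieBracket hX hY (s.isSmoothFn_η hZ) x
  have c2 := dirDeriv_mlieBracket hY hZ (s.isSmoothFn_η hX) x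
  have c3 := dirDeriv_mlieBracket hZ hX (s.isSmoothFn_η hY) x
  have j := congrArg (s.η x) (congrFun (jacobi_mlieBracket hX hY hZ) x)
  rw [Pi.add_apply, map_add, mlieBracket_swap_apply (V := X) (W := mlieBracket _ Y Z),
    mlieBracket_swap_apply (V := Y) (W := mlieBracket _ X Z),
    mlieBracket_swap (V := X) (W := Z)] at j
  have k : mlieBracket (𝓡 (2 * n + 1)) (-mlieBracket (𝓡 (2 * n + 1)) Z X) Y x
      = -mlieBracket (𝓡 (2 * n + 1)) (mlieBracket (𝓡 (2 * n + 1)) Z X) Y x := by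
    have := mlieBracket_const_smul_left (c := (-1 : ℝ)) (W := Y)
      ((hZ.mlieBracket hX).mdifferentiableAt x)
    simpa using this
  rw [k] at j
  simp only [map_neg] at j
  -- This is `d² = 0` for `η`: the second derivatives pair into commutators, and the nested brackets
  -- cancel by Jacobi.
  linarith

/-- On a normal contact metric manifold, `ξ` preserves `φ`. -/
theorem IsSasakian.mlieBracket_ξ_φ (hs : s.IsSasakian) {X : VF n M} (hX : IsSmoothVF X) (x : M) :
    mlieBracket (𝓡 (2 * n + 1)) s.ξ (fun y ↦ s.φ y (X y)) x
      = s.φ x (mlieBracket (𝓡 (2 * n + 1)) s.ξ X x) := by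
  have h0 : (fun y ↦ s.φ y (s.ξ y)) = (0 : VF n M) := funext s.φ_ξ
  have h1 := hs.2 s.ξ X s.smooth_ξ hX x
  rw [hs.1 s.ξ X s.smooth_ξ hX, inner_ξ_left, η_φ, nijenhuis, h0, mlieBracket_zero_left,
    mlieBracket_zero_left] at h1
  have h2 := hs.1.two_mul_inner_φ s.smooth_ξ (s.isSmoothVF_φ hX) x
  simp only [inner_ξ_left, η_φ, s.η_ξ, dirDeriv_const] at h2
  set u := mlieBracket (𝓡 (2 * n + 1)) s.ξ X x
  set w := mlieBracket (𝓡 (2 * n + 1)) s.ξ (fun y ↦ s.φ y (X y)) x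
  -- Normality of the pair `ξ, X` gives only `φ(φu - w) = 0`. The contact condition for `ξ, φX` adds
  -- `η(w) = 0`, and `φ` is injective on the kernel of `η`.
  have h3 : s.φ x (s.φ x u - w) = 0 := by
    rw [map_sub]
    simpa using h1
  have h4 := s.φ_φ x (s.φ x u - w)
  rw [h3, map_zero, map_sub, η_φ, show s.η x w = 0 by linarith] at h4
  simp only [sub_self, zero_smul, add_zero] at h4
  rw [eq_comm, neg_eq_zero, sub_eq_zero] at h4
  exact h4.symm

/-- The structure vector field of a Sasakian manifold satisfies `∇_X ξ = -φ X`. -/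
theorem IsSasakian.leviCivita_ξ [T2Space M] (hs : s.IsSasakian) {X : VF n M} (hX : IsSmoothVF X)
    (x : M) : leviCivita s.g X s.ξ x = -s.φ x (X x) := by
  rw [← add_eq_zero_iff_eq_neg]
  refine s.eq_zero_of_inner_φ ?_ fun w ↦ ?_
  -- The `ξ`-component vanishes because `g(ξ,ξ)` is constant.
  · have h := congrFun (dirDeriv_inner s.g hX s.smooth_ξ s.smooth_ξ) x
    simp only [inner_ξ_left, inner_ξ_right, s.η_ξ, dirDeriv_const] at h
    rw [map_add, η_φ]
    linarith
  · obtain ⟨W, hW, rfl⟩ := exists_isSmoothVF_apply_eq w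
    have hφW := s.isSmoothVF_φ hW
    -- In the Koszul formula, the terms forming `2dη(X, φW)` give `2g(X, φ²W)`. The remaining terms
    -- cancel: closedness and `[ξ, φW] = φ[ξ, W]` say that the flow of `ξ` preserves `Φ`.
    have h1 := inner_leviCivita s.g hX s.smooth_ξ hφW x
    have h2 := hs.1.two_mul_inner_φ hX hφW x
    have h3 := hs.1.closed s.smooth_ξ hX hW x
    rw [koszul_eq_dirDeriv, hs.mlieBracket_ξ_φ hW] at h1
    simp only [inner_ξ_left, inner_ξ_right, η_φ, φ_ξ, map_zero, dirDeriv_const,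
      mlieBracket_swap_apply (V := X) (W := s.ξ), mlieBracket_swap_apply (V := W) (W := s.ξ),
      map_neg, neg_apply, inner_φ_left] at h1 h2 h3
    rw [map_add, add_apply, inner_φ_left, h1]
    linarith

end AlmostContactMetric

/-! ### The covariant derivative of `φ` -/

namespace AlmostContactMetric

variable {n : ℕ} {M : Type*} [TopologicalSpace M] [ChartedSpace (ModelE n) M]
  [IsManifold (𝓡 (2 * n + 1)) ∞ M] {s : AlmostContactMetric n M}

variable (s) in
/-- The covariant derivative `(∇_X φ) Y = ∇_X (φ Y) - φ (∇_X Y)`. -/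
noncomputable def covDerivφ (X Y : VF n M) (x : M) : TangentSpace (𝓡 (2 * n + 1)) x :=
  leviCivita s.g X (fun y ↦ s.φ y (Y y)) x - s.φ x (leviCivita s.g X Y x)

variable (s) in
theorem inner_covDerivφ (X Y : VF n M) (x : M) (z : TangentSpace (𝓡 (2 * n + 1)) x) :
    s.g.inner x (s.covDerivφ X Y x) z = s.g.inner x (leviCivita s.g X (fun y ↦ s.φ y (Y y)) x) z
      + s.g.inner x (leviCivita s.g X Y x) (s.φ x z) := by
  rw [covDerivφ, map_sub, sub_apply, inner_φ_left, sub_neg_eq_add]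

/-- Differentiating `g(φY,Z) = -g(Y,φZ)` shows that `∇_X φ` inherits the skew-adjointness of `φ`. -/
theorem inner_covDerivφ_skew {X Y Z : VF n M} (hX : IsSmoothVF X) (hY : IsSmoothVF Y)
    (hZ : IsSmoothVF Z) (x : M) :
    s.g.inner x (s.covDerivφ X Y x) (Z x) = -s.g.inner x (s.covDerivφ X Z x) (Y x) := by
  have h1 := congrFun (dirDeriv_inner s.g hX (s.isSmoothVF_φ hY) hZ) x
  have h2 := congrFun (dirDeriv_inner s.g hX hY (s.isSmoothVF_φ hZ)) x
  simp only [inner_φ_left, dirDeriv_neg] at h1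
  rw [inner_covDerivφ, inner_covDerivφ, s.g.symm x _ (Y x), s.g.symm x _ (s.φ x (Y x)),
    inner_φ_left]
  linarith

/-- This is `dΦ = 0` with brackets replaced by covariant derivatives, the connection being
torsion-free. -/
theorem IsContactMetric.inner_covDerivφ_cyclic [T2Space M] (hs : s.IsContactMetric)
    {X Y Z : VF n M} (hX : IsSmoothVF X) (hY : IsSmoothVF Y) (hZ : IsSmoothVF Z) (x : M) :
    s.g.inner x (s.covDerivφ X Y x) (Z x) + s.g.inner x (s.covDerivφ Y Z x) (X x)
      + s.g.inner x (s.covDerivφ Z X x) (Y x) = 0 := by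
  have h := hs.closed hX hY hZ x
  rw [dirDeriv_inner s.g hX hY (s.isSmoothVF_φ hZ), dirDeriv_inner s.g hY hZ (s.isSmoothVF_φ hX),
    dirDeriv_inner s.g hZ hX (s.isSmoothVF_φ hY), ← leviCivita_sub_leviCivita s.g hX hY,
    ← leviCivita_sub_leviCivita s.g hY hZ, ← leviCivita_sub_leviCivita s.g hZ hX] at h
  rw [inner_covDerivφ_skew hX hY hZ, inner_covDerivφ_skew hY hZ hX, inner_covDerivφ_skew hZ hX hY]
  simp only [inner_covDerivφ, map_sub, sub_apply] at h ⊢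
  rw [s.g.symm x (Y x), s.g.symm x (Z x), s.g.symm x (X x)] at h
  linarith

/-- Obtained by differentiating `φ² = -I + η ⊗ ξ` and inserting `∇_X ξ = -φX`; it moves `φ` from one
argument of `∇_X φ` to the other. -/
theorem IsSasakian.inner_covDerivφ_φ [T2Space M] (hs : s.IsSasakian)
    {X Y Z : VF n M} (hX : IsSmoothVF X) (hY : IsSmoothVF Y) (hZ : IsSmoothVF Z) (x : M) :
    s.g.inner x (s.covDerivφ X (fun y ↦ s.φ y (Y y)) x) (Z x)
      - s.g.inner x (s.covDerivφ X Y x) (s.φ x (Z x))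
      = s.g.inner x (X x) (s.φ x (Y x)) * s.η x (Z x)
        + s.η x (Y x) * s.g.inner x (X x) (s.φ x (Z x)) := by
  have hφ := s.isSmoothVF_φ (s.isSmoothVF_φ hY)
  have h1 := congrFun (dirDeriv_inner s.g hX hφ hZ) x
  have h2 := congrFun (dirDeriv_inner s.g hX hY hZ) x
  have h3 := congrFun (dirDeriv_inner s.g hX hY s.smooth_ξ) x
  have h4 := congrFun (dirDeriv_inner s.g hX hZ s.smooth_ξ) x
  have e : (fun y ↦ s.g.inner y (s.φ y (s.φ y (Y y))) (Z y))
      = fun y ↦ s.η y (Y y) * s.η y (Z y) - s.g.inner y (Y y) (Z y) := by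
    funext y
    simp [s.φ_φ, inner_ξ_left]
    ring
  rw [e, dirDeriv_sub X (f₁ := fun y ↦ s.η y (Y y) * s.η y (Z y))
      ((s.isSmoothFn_η hY).mul (s.isSmoothFn_η hZ)) (s.g.isSmoothFn_inner hY hZ),
    dirDeriv_mul X (s.isSmoothFn_η hY) (s.isSmoothFn_η hZ)] at h1
  simp only [inner_ξ_right, hs.leviCivita_ξ hX, map_neg] at h3 h4
  rw [inner_covDerivφ, inner_covDerivφ]
  rw [h2, h3, h4] at h1
  simp only [s.φ_φ, map_add, map_neg, map_smul, add_apply, neg_apply, smul_apply, smul_eq_mul,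
    inner_ξ_left, inner_ξ_right] at h1 ⊢
  have h5 := s.inner_φ_left x (X x) (Y x)
  have h6 := s.inner_φ_left x (X x) (Z x)
  rw [s.g.symm] at h5 h6
  rw [h5, h6] at h1
  linear_combination -h1

/-- Normality with every bracket expressed through the torsion-free connection; only derivatives of
`φ` survive. -/
theorem IsSasakian.inner_covDerivφ_normal [T2Space M] (hs : s.IsSasakian)
    {X Y : VF n M} (hX : IsSmoothVF X) (hY : IsSmoothVF Y) (x : M)
    (z : TangentSpace (𝓡 (2 * n + 1)) x) :
    s.g.inner x (s.covDerivφ (fun y ↦ s.φ y (X y)) Y x) z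
      - s.g.inner x (s.covDerivφ (fun y ↦ s.φ y (Y y)) X x) z
      + s.g.inner x (s.covDerivφ X Y x) (s.φ x z) - s.g.inner x (s.covDerivφ Y X x) (s.φ x z)
      + 2 * s.g.inner x (X x) (s.φ x (Y x)) * s.η x z = 0 := by
  have h := congrArg (fun v ↦ s.g.inner x v z) (hs.2 X Y hX hY x)
  have hφX := s.isSmoothVF_φ hX
  have hφY := s.isSmoothVF_φ hY
  simp only [hs.1 X Y hX hY, nijenhuis, ← leviCivita_sub_leviCivita s.g hX hY,
    ← leviCivita_sub_leviCivita s.g hφX hφY, ← leviCivita_sub_leviCivita s.g hφX hY,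
    ← leviCivita_sub_leviCivita s.g hX hφY, map_add, map_sub, map_smul, map_zero, add_apply,
    sub_apply, smul_apply, zero_apply, smul_eq_mul, inner_φ_left, inner_ξ_left] at h
  simp only [inner_covDerivφ]
  linear_combination h

/-- The covariant derivative of `φ` on a Sasakian manifold: `(∇_X φ) Y = g(X, Y) ξ - η(Y) X`. -/
theorem IsSasakian.covDerivφ_eq [T2Space M] (hs : s.IsSasakian) {X Y : VF n M}
    (hX : IsSmoothVF X) (hY : IsSmoothVF Y) (x : M) :
    s.covDerivφ X Y x = s.g.inner x (X x) (Y x) • s.ξ x - s.η x (Y x) • X x := by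
  rw [← sub_eq_zero]
  refine s.eq_zero_of_inner_φ ?_ fun w ↦ ?_
  · have h := congrFun (dirDeriv_inner s.g hX (s.isSmoothVF_φ hY) s.smooth_ξ) x
    simp only [inner_ξ_right, η_φ, dirDeriv_const, hs.leviCivita_ξ hX, map_neg, s.g_φ_φ] at h
    have e := s.inner_covDerivφ X Y x (s.ξ x)
    rw [φ_ξ, map_zero, inner_ξ_right, inner_ξ_right] at e
    simp only [map_sub, map_smul, smul_eq_mul, s.η_ξ, e]
    rw [s.g.symm x (X x)]
    linarith
  · obtain ⟨Z, hZ, rfl⟩ := exists_isSmoothVF_apply_eq w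
    have hφY := s.isSmoothVF_φ hY
    have hφZ := s.isSmoothVF_φ hZ
    have swap (a b : TangentSpace (𝓡 (2 * n + 1)) x) :
        s.g.inner x a (s.φ x b) = -s.g.inner x b (s.φ x a) := by
      rw [← inner_φ_left, s.g.symm]
    -- In `n1`, the cyclic identities `c1`, `c2` trade derivatives along `φZ`, `φY` for derivatives
    -- along `X`, `Y`, `Z`. Then `p2`, `p3` evaluate those along `Y`, `Z`, and `p1` merges those
    -- along `X` into `2g((∇_X φ)Y, φZ)`.
    have n1 := hs.inner_covDerivφ_normal hZ hY x (X x)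
    have c1 := hs.1.inner_covDerivφ_cyclic hφZ hY hX x
    have c2 := hs.1.inner_covDerivφ_cyclic hφY hZ hX x
    have p1 := hs.inner_covDerivφ_φ hX hY hZ x
    have p2 := hs.inner_covDerivφ_φ hY hZ hX x
    have p3 := hs.inner_covDerivφ_φ hZ hY hX x
    have k1 := inner_covDerivφ_skew (s := s) hY hX hφZ x
    have k2 := inner_covDerivφ_skew (s := s) hZ hX hφY x
    have k3 := inner_covDerivφ_skew (s := s) hX hY hφZ x
    rw [swap (Y x) (X x)] at p2
    rw [swap (Z x) (X x), swap (Z x) (Y x)] at p3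
    rw [swap (Z x) (Y x)] at n1
    simp only [map_sub, map_smul, sub_apply, smul_apply, smul_eq_mul, inner_ξ_left, η_φ]
    linarith

/-! ### Curvature and Ricci tensor in the direction of `ξ` -/

/-- On a Sasakian manifold `R(X, Y) ξ = η(Y) X - η(X) Y`. -/
theorem IsSasakian.curvatureVF_ξ [T2Space M] (hs : s.IsSasakian) {X Y : VF n M}
    (hX : IsSmoothVF X) (hY : IsSmoothVF Y) (x : M) :
    curvatureVF s.g X Y s.ξ x = s.η x (Y x) • X x - s.η x (X x) • Y x := by
  have e {X : VF n M} (hX : IsSmoothVF X) : leviCivita s.g X s.ξ = fun y ↦ -s.φ y (X y) :=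
    funext (hs.leviCivita_ξ hX)
  have h1 := hs.covDerivφ_eq hX hY x
  have h2 := hs.covDerivφ_eq hY hX x
  -- Since `∇ξ = -φ`, the curvature is `R(X,Y)ξ = (∇_Y φ)X - (∇_X φ)Y`.
  rw [curvatureVF, hs.leviCivita_ξ (hX.mlieBracket hY), e hX, e hY, leviCivita_neg s.g hX (s.isSmoothVF_φ hY),
    leviCivita_neg s.g hY (s.isSmoothVF_φ hX), ← leviCivita_sub_leviCivita s.g hX hY, map_sub]
  rw [covDerivφ, sub_eq_iff_eq_add] at h1 h2
  rw [h1, h2, s.g.symm x (Y x)]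
  module

/-- Write `η` as the inner product with `ξ` and move `R(u,v)` onto `ξ` by skew-adjointness. -/
theorem IsSasakian.η_curvature [T2Space M] (hs : s.IsSasakian) (x : M)
    (u v w : TangentSpace (𝓡 (2 * n + 1)) x) :
    s.η x (curvature s.g x u v w) = s.g.inner x v w * s.η x u - s.g.inner x u w * s.η x v := by
  obtain ⟨U, V, W, hU, hV, hW, rfl, rfl, rfl, h⟩ := exists_curvature_eq_curvatureVF s.g u v w
  rw [h, ← inner_ξ_right, inner_curvatureVF_skew s.g hU hV hW s.smooth_ξ, hs.curvatureVF_ξ hU hV]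
  simp only [map_sub, map_smul, smul_eq_mul]
  rw [s.g.symm x (W x), s.g.symm x (W x)]
  ring

/-- The field `W` extending `ξ x` agrees with `ξ` only at `x`, so `curvatureVF_ξ` does not apply to
it directly. Using skew-adjointness twice, with the value at `x` in between, replaces `W` by `ξ`. -/
theorem IsSasakian.curvature_ξ [T2Space M] (hs : s.IsSasakian) (x : M)
    (u v : TangentSpace (𝓡 (2 * n + 1)) x) :
    curvature s.g x u v (s.ξ x) = s.η x v • u - s.η x u • v := by
  obtain ⟨U, V, W, hU, hV, hW, rfl, rfl, hWx, h⟩ :=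
    exists_curvature_eq_curvatureVF s.g u v (s.ξ x)
  refine s.g.eq_of_inner_vectorField_eq fun Z hZ ↦ ?_
  rw [h, inner_curvatureVF_skew s.g hU hV hW hZ, hWx, inner_ξ_left, ← inner_ξ_right,
    inner_curvatureVF_skew s.g hU hV hZ s.smooth_ξ, hs.curvatureVF_ξ hU hV, neg_neg, s.g.symm]

/-- The trace of `u ↦ a(v)u - a(u)v`: the identity contributes `(2n+1)a(v)` and the rank-one part
removes `a(v)`. -/
theorem sum_smul_single_sub_smul (a : ModelE n →L[ℝ] ℝ) (v : ModelE n) :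
    ∑ i, (a v • EuclideanSpace.single i (1 : ℝ) - a (EuclideanSpace.single i (1 : ℝ)) • v :
      ModelE n) i = 2 * n * a v := by
  have h : ∑ i, a (EuclideanSpace.single i (1 : ℝ)) * v i = a v := by
    conv_rhs => rw [← (EuclideanSpace.basisFun (Fin (2 * n + 1)) ℝ).sum_repr v, map_sum]
    exact Finset.sum_congr rfl fun i _ ↦ by simp [mul_comm]
  simp only [PiLp.sub_apply, PiLp.smul_apply, smul_eq_mul, PiLp.single_apply, if_true, mul_one,
    Finset.sum_sub_distrib, h]
  simp
  ring

/-- On a Sasakian manifold of dimension `2n+1`, `S(v, ξ) = 2n η(v)`. -/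
theorem IsSasakian.ricci_ξ [T2Space M] (hs : s.IsSasakian) (x : M)
    (v : TangentSpace (𝓡 (2 * n + 1)) x) : ricci s.g x v (s.ξ x) = 2 * n * s.η x v := by
  have h : (fun u ↦ curvature s.g x u v (s.ξ x)) = fun u ↦ s.η x v • u - s.η x u • v :=
    funext fun u ↦ hs.curvature_ξ x u v
  rw [ricci, h]
  exact sum_smul_single_sub_smul (s.η x) v

/-- An Einstein Sasakian manifold of dimension `2n+1` has Ricci tensor `S = 2n g`. -/
theorem IsSasakian.ricci_eq [T2Space M] (hs : s.IsSasakian) (hE : IsEinsteinMetric s.g) (x : M)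
    (v w : TangentSpace (𝓡 (2 * n + 1)) x) : ricci s.g x v w = 2 * n * s.g.inner x v w := by
  -- Evaluating at `(ξ, ξ)` identifies the Einstein factor `r/(2n+1)` as `2n`.
  have h := hs.ricci_ξ x (s.ξ x)
  rw [hE, inner_ξ_right, s.η_ξ, mul_one, mul_one] at h
  rw [hE, h]

theorem IsSasakian.ricciOp_eq [T2Space M] (hs : s.IsSasakian) (hE : IsEinsteinMetric s.g) (x : M)
    (v : TangentSpace (𝓡 (2 * n + 1)) x) : ricciOp s.g x v = (2 * n : ℝ) • v := by
  have hex : ∃ q : TangentSpace (𝓡 (2 * n + 1)) x, ∀ w, s.g.inner x q w = ricci s.g x v w :=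
    ⟨(2 * n : ℝ) • v, fun w ↦ by simp [hs.ricci_eq hE]⟩
  refine s.g.eq_of_inner_eq fun w ↦ ?_
  rw [ricciOp, Classical.epsilon_spec hex w, hs.ricci_eq hE]
  simp

/-- The curvature of a conharmonically flat Einstein Sasakian manifold. -/
theorem IsSasakian.curvature_eq_of_isConharmonicallyFlat [T2Space M] (hs : s.IsSasakian)
    (hC : IsConharmonicallyFlat s.g) (hE : IsEinsteinMetric s.g) (x : M)
    (u v w : TangentSpace (𝓡 (2 * n + 1)) x) :
    curvature s.g x u v w
      = (4 * (n : ℝ) / (2 * (n : ℝ) - 1)) • (s.g.inner x v w • u - s.g.inner x u w • v) := by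
  have h := hC x u v w
  rw [conharmonicTensor, sub_eq_zero] at h
  rw [h, hs.ricci_eq hE, hs.ricci_eq hE, hs.ricciOp_eq hE, hs.ricciOp_eq hE]
  -- The `4n` is `2n` from the two Ricci tensor terms plus `2n` from the two Ricci operator terms.
  module

end AlmostContactMetric

/-! ### Quasi-isometry bounds and the main theorem -/

/-- The bound is applied once, to the combined field `η(Y)X - η(X)Y`. Bounding the two terms
separately would need signs of `η` and would not keep a single `B`. -/
theorem IsQuasiIsometricEmbedding.bound_smul_sub {n : ℕ} {M₁ M₂ : Type*}
    [TopologicalSpace M₁] [ChartedSpace (ModelE n) M₁] [IsManifold (𝓡 (2 * n + 1)) ∞ M₁]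
    [TopologicalSpace M₂] [ChartedSpace (ModelE n) M₂] [IsManifold (𝓡 (2 * n + 1)) ∞ M₂]
    {s : AlmostContactMetric n M₁} {g₂ : RiemMetric n M₂} {f : M₁ → M₂} {A B : ℝ}
    (hf : IsQuasiIsometricEmbedding s.g g₂ f A B) {X Y W : VF n M₁}
    (hX : IsSmoothVF X) (hY : IsSmoothVF Y) (hW : IsSmoothVF W) (x : M₁) :
    1 / A * (s.g.inner x (X x) (W x) * s.η x (Y x) - s.g.inner x (Y x) (W x) * s.η x (X x)) - B ≤
        s.η x (Y x) * g₂.inner (f x) (mfderiv (𝓡 (2 * n + 1)) (𝓡 (2 * n + 1)) f x (X x))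
            (mfderiv (𝓡 (2 * n + 1)) (𝓡 (2 * n + 1)) f x (W x))
          - s.η x (X x) * g₂.inner (f x) (mfderiv (𝓡 (2 * n + 1)) (𝓡 (2 * n + 1)) f x (Y x))
            (mfderiv (𝓡 (2 * n + 1)) (𝓡 (2 * n + 1)) f x (W x)) ∧
      s.η x (Y x) * g₂.inner (f x) (mfderiv (𝓡 (2 * n + 1)) (𝓡 (2 * n + 1)) f x (X x))
            (mfderiv (𝓡 (2 * n + 1)) (𝓡 (2 * n + 1)) f x (W x))
          - s.η x (X x) * g₂.inner (f x) (mfderiv (𝓡 (2 * n + 1)) (𝓡 (2 * n + 1)) f x (Y x))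
            (mfderiv (𝓡 (2 * n + 1)) (𝓡 (2 * n + 1)) f x (W x)) ≤
        A * (s.g.inner x (X x) (W x) * s.η x (Y x) - s.g.inner x (Y x) (W x) * s.η x (X x)) + B := by
  have hU : IsSmoothVF (fun y ↦ s.η y (Y y) • X y - s.η y (X y) • Y y : VF n M₁) :=
    (IsSmoothVF.smul (s.isSmoothFn_η hY) hX).sub (IsSmoothVF.smul (s.isSmoothFn_η hX) hY)
  have h := hf.bound _ W hU hW x
  simp only [map_sub, map_smul, sub_apply, smul_apply, smul_eq_mul] at h
  rwa [mul_comm (s.g.inner x (X x) (W x)), mul_comm (s.g.inner x (Y x) (W x))]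

theorem theorem5p2 {n : ℕ} (hn : 1 ≤ n) {M₁ M₂ : Type*}
    [TopologicalSpace M₁] [T2Space M₁] [SecondCountableTopology M₁]
    [ChartedSpace (ModelE n) M₁] [IsManifold (𝓡 (2 * n + 1)) ∞ M₁]
    [TopologicalSpace M₂] [T2Space M₂] [SecondCountableTopology M₂]
    [ChartedSpace (ModelE n) M₂] [IsManifold (𝓡 (2 * n + 1)) ∞ M₂]
    (s₁ : AlmostContactMetric n M₁) (s₂ : AlmostContactMetric n M₂)
    (hs₁ : s₁.IsSasakian) (hs₂ : s₂.IsSasakian)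
    (f : M₁ → M₂) (A B : ℝ) (hf : IsQuasiIsometricEmbedding s₁.g s₂.g f A B) :
    ((IsConformallyFlat s₁.g ∨ (IsConformallyFlat s₁.g ∧ IsEinsteinMetric s₁.g) ∨
        IsConcircularlyFlat s₁.g ∨ IsProjectivelyFlat s₁.g) →
      ∀ X Y W : ∀ x : M₁, TangentSpace (𝓡 (2 * n + 1)) x,
        IsSmoothVF X → IsSmoothVF Y → IsSmoothVF W → ∀ x : M₁,
        1 / A * s₁.η x (curvature s₁.g x (Y x) (X x) (W x)) - B ≤
          s₁.η x (Y x) * s₂.g.inner (f x)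
              (mfderiv (𝓡 (2 * n + 1)) (𝓡 (2 * n + 1)) f x (X x))
              (mfderiv (𝓡 (2 * n + 1)) (𝓡 (2 * n + 1)) f x (W x))
            - s₁.η x (X x) * s₂.g.inner (f x)
              (mfderiv (𝓡 (2 * n + 1)) (𝓡 (2 * n + 1)) f x (Y x))
              (mfderiv (𝓡 (2 * n + 1)) (𝓡 (2 * n + 1)) f x (W x)) ∧
        s₁.η x (Y x) * s₂.g.inner (f x)
              (mfderiv (𝓡 (2 * n + 1)) (𝓡 (2 * n + 1)) f x (X x))
              (mfderiv (𝓡 (2 * n + 1)) (𝓡 (2 * n + 1)) f x (W x))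
            - s₁.η x (X x) * s₂.g.inner (f x)
              (mfderiv (𝓡 (2 * n + 1)) (𝓡 (2 * n + 1)) f x (Y x))
              (mfderiv (𝓡 (2 * n + 1)) (𝓡 (2 * n + 1)) f x (W x)) ≤
          A * s₁.η x (curvature s₁.g x (Y x) (X x) (W x)) + B) ∧
    ((IsConharmonicallyFlat s₁.g ∧ IsEinsteinMetric s₁.g) →
      ∀ X Y W : ∀ x : M₁, TangentSpace (𝓡 (2 * n + 1)) x,
        IsSmoothVF X → IsSmoothVF Y → IsSmoothVF W → ∀ x : M₁,
        (4 * (n : ℝ) / (2 * (n : ℝ) - 1)) / A *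
            s₁.η x (curvature s₁.g x (Y x) (X x) (W x)) - B ≤
          s₁.η x (Y x) * s₂.g.inner (f x)
              (mfderiv (𝓡 (2 * n + 1)) (𝓡 (2 * n + 1)) f x (X x))
              (mfderiv (𝓡 (2 * n + 1)) (𝓡 (2 * n + 1)) f x (W x))
            - s₁.η x (X x) * s₂.g.inner (f x)
              (mfderiv (𝓡 (2 * n + 1)) (𝓡 (2 * n + 1)) f x (Y x))
              (mfderiv (𝓡 (2 * n + 1)) (𝓡 (2 * n + 1)) f x (W x)) ∧
        s₁.η x (Y x) * s₂.g.inner (f x)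
              (mfderiv (𝓡 (2 * n + 1)) (𝓡 (2 * n + 1)) f x (X x))
              (mfderiv (𝓡 (2 * n + 1)) (𝓡 (2 * n + 1)) f x (W x))
            - s₁.η x (X x) * s₂.g.inner (f x)
              (mfderiv (𝓡 (2 * n + 1)) (𝓡 (2 * n + 1)) f x (Y x))
              (mfderiv (𝓡 (2 * n + 1)) (𝓡 (2 * n + 1)) f x (W x)) ≤
          (4 * (n : ℝ) / (2 * (n : ℝ) - 1)) * A *
            s₁.η x (curvature s₁.g x (Y x) (X x) (W x)) + B) := by
  refine ⟨fun _ X Y W hX hY hW x ↦ ?_, fun ⟨hC, hE⟩ X Y W hX hY hW x ↦ ?_⟩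
  · rw [hs₁.η_curvature]
    exact hf.bound_smul_sub hX hY hW x
  · have h := hf.bound_smul_sub hX hY hW x
    rw [← hs₁.η_curvature] at h
    -- The curvature is `c₁` times the tensor `g(v,w)u - g(u,w)v`, whose image under `η` is again
    -- `η(R)`.
    have e : 4 * (n : ℝ) / (2 * (n : ℝ) - 1) *
        s₁.η x (curvature s₁.g x (Y x) (X x) (W x)) = s₁.η x (curvature s₁.g x (Y x) (X x) (W x)) := by
      conv_rhs => rw [hs₁.curvature_eq_of_isConharmonicallyFlat hC hE]
      rw [hs₁.η_curvature]
      simp only [map_sub, map_smul, smul_eq_mul]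
    constructor
    · refine le_trans (le_of_eq ?_) h.1
      conv_rhs => rw [← e]
      ring
    · refine h.2.trans (le_of_eq ?_)
      conv_lhs => rw [← e]
      ring
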